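/- Let $n,m\in\mathbb N$. A ReLU network $N$ with $n$ input and $m$ output nodes is a layered feedforward network with rational weights and biases, finitely many (possibly no) hidden layers, the activation $\mathrm{ReLU}(x)=\max(0,x)$ at all hidden nodes and, at all output nodes, either always ReLU or always the identity (one of these two conventions is fixed throughout, and the result holds for either). It computes a function $N:\mathbb R^n\to\mathbb R^m$. We consider the following rules. - A rule $\varphi\Rightarrow\psi$ with $\varphi\subseteq\mathbb R^n$, $\psi\subseteq\mathbb R^m$ applies to $N$ if $x\in\varphi$ implies $N(x)\in\psi$ for all $x\in\mathbb R^n$. It is *propositional* if $\varphi$ and $\psi$ are Boolean combinations of sets $\{x\mid x_i\in I\}$, where $I$ is an interval with endpoints in $[-\infty,\infty]$. It is *oblique* if $\varphi$ and $\psi$ are Boolean combinations of half-spaces. It is *MofN* if there are $\square\in\{\le,=,\ge\}$, $t,r\in\mathbb N$ and Boolean combinations $\varphi_1,\dots,\varphi_t$ of half-spaces with $x\in\varphi\Leftrightarrow|\{i\mid x\in\varphi_i\}|\mathrel{\square}r$ (and $\psi$ is arbitrary). - For $A\in\mathbb Q^{\ell\times n}$ and $i\in\{1,\dots,m\}$,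 the *monotonicity rule* $(A,i)$ applies to $N$ if for all $x,y\in\mathbb R^n$ such that $N(x)_i=\max_jN(x)_j$ and $Ax\le Ay$ (componentwise), we have $N(y)_i=\max_jN(y)_j$. The *total monotonicity rule* $(A,i)$ applies to $N$ if $Ax\le Ay$ implies $N(x)_i\le N(y)_i$ for all $x,y\in\mathbb R^n$. A network obeys a set $R$ of rules if every rule in $R$ applies to it. The set $R$ is *consistent* if some ReLU network obeys $R$. It is *exhaustive* if for every $x\in\mathbb R^n$ there is at most one $y\in\mathbb R^m$ such that $N'(x)=y$ for some ReLU network $N'$ that obeys $R$. **Theorem.** Let $R$ be a finite, consistent and exhaustive set of such rules, and let $N$ be a ReLU network that obeys $R$. 1. If every rule in $R$ is propositional, oblique or MofN, then $N$ computes a constant function. 2. If $m\ge1$, then $R$ does not consist solely of monotonicity and total monotonicity rules. -/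

import Mathlib

namespace RuleExtraction

/-- The activation function `x ↦ max 0 x`. -/
noncomputable def relu (x : ℝ) : ℝ := max 0 x

/-- The function computed by one layer with weight matrix `W`, bias vector `b` (both rational)
and activation `σ` at each of its nodes. -/
noncomputable def layer {n k : ℕ} (σ : ℝ → ℝ) (W : Matrix (Fin k) (Fin n) ℚ) (b : Fin k → ℚ)
    (x : Fin n → ℝ) : Fin k → ℝ :=
  fun i => σ ((∑ j, (W i j : ℝ) * x j) + (b i : ℝ))

/-- The activation of the output nodes: the two customary conventions. -/
inductive OutputActivation
  | relu
  | identity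

noncomputable def OutputActivation.toFun : OutputActivation → ℝ → ℝ
  | .relu => RuleExtraction.relu
  | .identity => id

/-- A feedforward ReLU network with `n` input nodes, `m` output nodes and rational weights and
biases: finitely many (possibly no) hidden layers, followed by the output layer. -/
inductive ReLUNet : ℕ → ℕ → Type
  | output {n m : ℕ} (W : Matrix (Fin m) (Fin n) ℚ) (b : Fin m → ℚ) : ReLUNet n m
  | hidden {n k m : ℕ} (W : Matrix (Fin k) (Fin n) ℚ) (b : Fin k → ℚ) (rest : ReLUNet k m) :
      ReLUNet n m

/-- The function computed by a ReLU network: every hidden node applies ReLU, every output node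
applies the activation `out`. -/
noncomputable def ReLUNet.eval (out : OutputActivation) :
    {n m : ℕ} → ReLUNet n m → (Fin n → ℝ) → (Fin m → ℝ)
  | _, _, .output W b, x => layer out.toFun W b x
  | _, _, .hidden W b rest, x => rest.eval out (layer RuleExtraction.relu W b x)

/-- The sets `{x | x i ∈ I}` for a closed or open interval `I` with endpoints in `[-∞, ∞]`. -/
def paraxialSets (d : ℕ) : Set (Set (Fin d → ℝ)) :=
  {S | ∃ (i : Fin d) (a b : EReal),
    S = {x | (x i : EReal) ∈ Set.Icc a b} ∨ S = {x | (x i : EReal) ∈ Set.Ioo a b}}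

/-- The closed half-spaces; the open ones are complements of these. -/
def halfSpaces (d : ℕ) : Set (Set (Fin d → ℝ)) :=
  {S | ∃ (a : Fin d → ℝ) (c : ℝ), a ≠ 0 ∧ S = {x | ∑ i, a i * x i ≤ c}}

/-- `S` is a (finite) Boolean combination of sets from `G`. -/
def IsBooleanCombination {X : Type} (G : Set (Set X)) (S : Set X) : Prop :=
  S ∈ BooleanSubalgebra.closure G

/-- A rule for functions `ℝⁿ → ℝᵐ`: an implication `φ ⇒ ψ`, given by the sets whose indicator
functions are `φ` and `ψ`, a monotonicity rule `(A, i)` or a total monotonicity rule `(A, i)`. -/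
inductive Rule (n m : ℕ) : Type
  | implication (φ : Set (Fin n → ℝ)) (ψ : Set (Fin m → ℝ))
  | monotonicity {l : ℕ} (A : Matrix (Fin l) (Fin n) ℚ) (i : Fin m)
  | totalMonotonicity {l : ℕ} (A : Matrix (Fin l) (Fin n) ℚ) (i : Fin m)

/-- The componentwise inequality `A x ≤ A y`. -/
def MatrixLE {l n : ℕ} (A : Matrix (Fin l) (Fin n) ℚ) (x y : Fin n → ℝ) : Prop :=
  ∀ k, ∑ j, (A k j : ℝ) * x j ≤ ∑ j, (A k j : ℝ) * y j

/-- `argmax_j v_j = i`, in the sense that `v_i` is at least as big as every other entry. -/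
def IsArgmax {m : ℕ} (v : Fin m → ℝ) (i : Fin m) : Prop := ∀ j, v j ≤ v i

/-- The rule applies to the function `f`. -/
def Rule.Applies {n m : ℕ} (f : (Fin n → ℝ) → (Fin m → ℝ)) : Rule n m → Prop
  | .implication φ ψ => ∀ x, x ∈ φ → f x ∈ ψ
  | .monotonicity A i => ∀ x y, IsArgmax (f x) i ∧ MatrixLE A x y → IsArgmax (f y) i
  | .totalMonotonicity A i => ∀ x y, MatrixLE A x y → f x i ≤ f y i

def Rule.IsPropositional {n m : ℕ} (r : Rule n m) : Prop :=
  ∃ φ ψ, r = .implication φ ψ ∧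
    IsBooleanCombination (paraxialSets n) φ ∧ IsBooleanCombination (paraxialSets m) ψ

def Rule.IsOblique {n m : ℕ} (r : Rule n m) : Prop :=
  ∃ φ ψ, r = .implication φ ψ ∧
    IsBooleanCombination (halfSpaces n) φ ∧ IsBooleanCombination (halfSpaces m) ψ

/-- The relations `≤`, `=`, `≥` on `ℕ`. -/
inductive Comparison
  | le
  | eq
  | ge

def Comparison.Holds : Comparison → ℕ → ℕ → Prop
  | .le, a, b => a ≤ b
  | .eq, a, b => a = b
  | .ge, a, b => a ≥ b

/-- The condition of an MofN rule counts how many of `φ₁, …, φₜ` hold; its conclusion part may be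
any set. -/
def Rule.IsMofN {n m : ℕ} (r : Rule n m) : Prop :=
  ∃ (φ : Set (Fin n → ℝ)) (ψ : Set (Fin m → ℝ)), r = .implication φ ψ ∧
    ∃ (cmp : Comparison) (t s : ℕ) (φs : Fin t → Set (Fin n → ℝ)),
      (∀ i, IsBooleanCombination (halfSpaces n) (φs i)) ∧
      ∀ x, x ∈ φ ↔ cmp.Holds (Set.ncard {i | x ∈ φs i}) s

def Rule.IsMonotonicity {n m : ℕ} (r : Rule n m) : Prop :=
  ∃ (l : ℕ) (A : Matrix (Fin l) (Fin n) ℚ) (i : Fin m), r = .monotonicity A i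

def Rule.IsTotalMonotonicity {n m : ℕ} (r : Rule n m) : Prop :=
  ∃ (l : ℕ) (A : Matrix (Fin l) (Fin n) ℚ) (i : Fin m), r = .totalMonotonicity A i

/-- The network obeys all rules in `R`. -/
def ReLUNet.Obeys {n m : ℕ} (out : OutputActivation) (N : ReLUNet n m) (R : Set (Rule n m)) :
    Prop :=
  ∀ r ∈ R, r.Applies (N.eval out)

/-- Some ReLU network obeys all rules in `R`. -/
def Consistent {n m : ℕ} (out : OutputActivation) (R : Set (Rule n m)) : Prop :=
  ∃ N : ReLUNet n m, N.Obeys out R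

/-- For every input `x` there is at most one output `y` such that `N x = y` is possible for a ReLU
network `N` that obeys all rules in `R`. -/
def Exhaustive {n m : ℕ} (out : OutputActivation) (R : Set (Rule n m)) : Prop :=
  ∀ (x : Fin n → ℝ) (y y' : Fin m → ℝ),
    (∃ N : ReLUNet n m, N.Obeys out R ∧ N.eval out x = y) →
    (∃ N : ReLUNet n m, N.Obeys out R ∧ N.eval out x = y') → y = y'

end RuleExtraction

namespace RuleExtraction

open Set

/-! ### Functions computed by ReLU networks -/

/-! The conditions of finitely many propositional, oblique or MofN rules depend only on the position
of `x` relative to finitely many hyperplanes. Suppose that `N` is not constant on some open cell of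
this arrangement. Then the input can be pushed around inside the cell by a piecewise linear bump
(`exists_eval_comp_bump`, `exists_perturbation`). The new network differs from `N`, but on each cell
it takes only values that `N` takes there, so every implication survives, whatever its conclusion
is. This contradicts exhaustiveness. Hence `N` is constant on each open cell. The open cells are
finite in number and have a dense union, so continuity and connectedness make `N` constant
(`exists_eq_const_of_const_on_cells`). For monotonicity rules, adding `1` to every output preserves
all order comparisons, so the output is never unique. -/

theorem ratCast_ite (p : Prop) [Decidable p] (a b : ℚ) :
    (((if p then a else b : ℚ)) : ℝ) = if p then (a : ℝ) else (b : ℝ) := by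
  split_ifs <;> rfl

theorem continuous_eval (out : OutputActivation) {n m : ℕ} (N : ReLUNet n m) :
    Continuous (N.eval out) := by
  have hrelu : Continuous relu := continuous_const.max continuous_id
  have hout : Continuous out.toFun := by
    cases out
    · exact hrelu
    · exact continuous_id
  induction N with
  | output W b =>
    change Continuous (layer out.toFun W b)
    unfold layer
    exact continuous_pi fun i => hout.comp (by fun_prop)
  | hidden W b rest ih =>
    change Continuous (rest.eval out ∘ layer relu W b)
    unfold layer
    exact ih.comp (continuous_pi fun i => hrelu.comp (by fun_prop))

/-- Adding `1` to all outputs of a network yields a function that is computed by a network. -/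
theorem exists_eval_add_one (out : OutputActivation) {n m : ℕ} (N : ReLUNet n m) :
    ∃ N' : ReLUNet n m, ∀ x i, N'.eval out x i = N.eval out x i + 1 := by
  induction N with
  | @output n m W b =>
    cases out
    -- The old outputs are nonnegative, so the ReLU of the additional layer does not alter their sum
    -- with `1`.
    · refine ⟨.hidden W b (.output 1 1), fun x i => ?_⟩
      simp only [ReLUNet.eval, layer, OutputActivation.toFun, Matrix.one_apply, Pi.one_apply]
      simp only [relu, ratCast_ite, Rat.cast_one, Rat.cast_zero, ite_mul, one_mul, zero_mul,
        Finset.sum_ite_eq, Finset.mem_univ, if_true]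
      exact max_eq_right (add_nonneg (le_max_left _ _) zero_le_one)
    · refine ⟨.output W (b + 1), fun x i => ?_⟩
      simp [ReLUNet.eval, layer, OutputActivation.toFun, add_assoc]
  | hidden W b rest ih =>
    obtain ⟨N', h⟩ := ih
    exact ⟨.hidden W b N', fun x i => h _ i⟩

/-- The function `F`, whose inputs are indexed by a finite type, is computed by a network. -/
def IsComputable (out : OutputActivation) {m : ℕ} {ι : Type} (F : (ι → ℝ) → (Fin m → ℝ)) : Prop :=
  ∃ (k : ℕ) (e : Fin k ≃ ι) (N : ReLUNet k m), ∀ x, N.eval out (x ∘ e) = F x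

theorem IsComputable.comp_relu {out : OutputActivation} {m : ℕ} {ι κ : Type} [Fintype ι]
    {F : (κ → ℝ) → (Fin m → ℝ)} (hF : IsComputable out F) (W : Matrix κ ι ℚ) (b : κ → ℚ) :
    IsComputable out fun x : ι → ℝ => F fun i => relu ((∑ j, (W i j : ℝ) * x j) + (b i : ℝ)) := by
  obtain ⟨k, e, N, h⟩ := hF
  let e' := (Fintype.equivFin ι).symm
  refine ⟨_, e', .hidden (W.submatrix e e') (b ∘ e) N, fun x => ?_⟩
  refine Eq.trans ?_ (h _)
  simp only [ReLUNet.eval]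
  congr 1
  funext i
  simp only [layer, Matrix.submatrix_apply, Function.comp_apply]
  rw [e'.sum_comp fun j => (W (e i) j : ℝ) * x j]

/-- The first layer is affine before its activation, so it absorbs an affine map without a new
layer. -/
theorem exists_eval_comp_affine (out : OutputActivation) {n k m : ℕ} (N : ReLUNet k m)
    (W : Matrix (Fin k) (Fin n) ℚ) (b : Fin k → ℚ) :
    ∃ N' : ReLUNet n m, ∀ x,
      N'.eval out x = N.eval out fun i => (∑ j, (W i j : ℝ) * x j) + (b i : ℝ) := by
  have key (l : ℕ) (V : Matrix (Fin l) (Fin k) ℚ) (c : Fin l → ℚ) (σ : ℝ → ℝ) (x : Fin n → ℝ) :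
      layer σ (V * W) (V.mulVec b + c) x =
        layer σ V c fun i => (∑ j, (W i j : ℝ) * x j) + (b i : ℝ) := by
    funext i
    simp only [layer, Matrix.mul_apply, Matrix.mulVec, dotProduct, Pi.add_apply]
    push_cast
    simp only [mul_add, Finset.sum_add_distrib, Finset.mul_sum, Finset.sum_mul]
    rw [Finset.sum_comm]
    simp only [mul_assoc, add_assoc]
  cases N with
  | output V c => exact ⟨.output (V * W) (V.mulVec b + c), fun x => key _ V c _ x⟩
  | hidden V c rest =>
    exact ⟨.hidden (V * W) (V.mulVec b + c) rest, fun x => congrArg _ (key _ V c _ x)⟩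

theorem IsComputable.comp_affine {out : OutputActivation} {m : ℕ} {ι κ : Type} [Fintype ι]
    {F : (κ → ℝ) → (Fin m → ℝ)} (hF : IsComputable out F) (W : Matrix κ ι ℚ) (b : κ → ℚ) :
    IsComputable out fun x : ι → ℝ => F fun i => (∑ j, (W i j : ℝ) * x j) + (b i : ℝ) := by
  obtain ⟨k, e, N, h⟩ := hF
  let e' := (Fintype.equivFin ι).symm
  obtain ⟨N', h'⟩ := exists_eval_comp_affine out N (W.submatrix e e') (b ∘ e)
  refine ⟨_, e', N', fun x => ?_⟩
  refine Eq.trans (h' _) (Eq.trans ?_ (h _))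
  congr 1
  funext i
  simp only [Matrix.submatrix_apply, Function.comp_apply]
  rw [e'.sum_comp fun j => (W (e i) j : ℝ) * x j]

theorem IsComputable.exists_eval {out : OutputActivation} {n m : ℕ}
    {F : (Fin n → ℝ) → (Fin m → ℝ)} (hF : IsComputable out F) :
    ∃ N : ReLUNet n m, ∀ x, N.eval out x = F x := by
  obtain ⟨k, e, N, h⟩ := hF
  obtain rfl : k = n := by simpa using Fintype.card_congr e
  obtain ⟨N', h'⟩ := exists_eval_comp_affine out N ((1 : Matrix (Fin k) (Fin k) ℚ).submatrix e id) 0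
  refine ⟨N', fun x => ?_⟩
  rw [← h, h']
  congr 1
  funext i
  simp [Matrix.one_apply, ratCast_ite]

/-- A piecewise linear bump function around `q`. -/
noncomputable def bump {n : ℕ} (q : Fin n → ℚ) (K : ℕ) (x : Fin n → ℝ) : ℝ :=
  relu (1 - K * ∑ i, |x i - q i|)

theorem bump_nonneg {n : ℕ} (q : Fin n → ℚ) (K : ℕ) (x : Fin n → ℝ) : 0 ≤ bump q K x :=
  le_max_left _ _

theorem bump_le_one {n : ℕ} (q : Fin n → ℚ) (K : ℕ) (x : Fin n → ℝ) : bump q K x ≤ 1 :=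
  max_le zero_le_one (sub_le_self _ (by positivity))

theorem bump_self {n : ℕ} (q : Fin n → ℚ) (K : ℕ) : bump q K (fun i => (q i : ℝ)) = 1 := by
  simp [bump, relu]

/-- The bump vanishes outside an `ℓ¹` ball of radius `1 / K`, and the `ℓ¹` norm dominates the sup
norm. -/
theorem dist_lt_of_bump_ne_zero {n : ℕ} {q : Fin n → ℚ} {K : ℕ} {x : Fin n → ℝ} {ε : ℝ}
    (hε : 0 < ε) (hK : 1 ≤ K * ε) (h : bump q K x ≠ 0) : dist x (fun i => (q i : ℝ)) < ε := by
  have hpos : 0 < 1 - K * ∑ i, |x i - q i| := by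
    by_contra hle
    exact h (max_eq_left (not_lt.1 hle))
  refine (dist_pi_lt_iff hε).2 fun i => ?_
  rw [Real.dist_eq]
  have hi : |x i - q i| ≤ ∑ i, |x i - q i| :=
    Finset.single_le_sum (f := fun i => |x i - q i|) (fun _ _ => abs_nonneg _) (Finset.mem_univ i)
  have : (K : ℝ) * ∑ i, |x i - q i| < K * ε := by linarith
  exact hi.trans_lt (lt_of_mul_lt_mul_left this (Nat.cast_nonneg K))

/-- Precomposing a network with a local perturbation of the identity yields a network. -/
theorem exists_eval_comp_bump (out : OutputActivation) {n m : ℕ} (N : ReLUNet n m)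
    (q v : Fin n → ℚ) (K : ℕ) :
    ∃ N' : ReLUNet n m, ∀ x,
      N'.eval out x = N.eval out fun i => x i + bump q K x * v i := by
  have h0 : IsComputable out (N.eval out) := ⟨n, Equiv.refl _, N, fun x => rfl⟩
  -- `W₁` yields the positive and negative parts of `x - q`. `W₂` copies them, as ReLU is
  -- idempotent, and adds one node (`none`) for the bump, since the two parts sum to the absolute
  -- value. `W₃` with bias `q` recovers `x` from the parts and adds the bump times `v`.
  let W₃ : Matrix (Fin n) (Option (Fin n ⊕ Fin n)) ℚ := fun i j => match j with
    | none => v i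
    | some (.inl j) => if i = j then 1 else 0
    | some (.inr j) => if i = j then -1 else 0
  let W₂ : Matrix (Option (Fin n ⊕ Fin n)) (Fin n ⊕ Fin n) ℚ := fun i j => match i with
    | none => -K
    | some i => if i = j then 1 else 0
  let b₂ : Option (Fin n ⊕ Fin n) → ℚ := fun i => match i with
    | none => 1
    | some _ => 0
  let W₁ : Matrix (Fin n ⊕ Fin n) (Fin n) ℚ := fun i j => match i with
    | .inl i => if i = j then 1 else 0
    | .inr i => if i = j then -1 else 0
  let b₁ : Fin n ⊕ Fin n → ℚ := Sum.elim (fun i => -q i) q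
  obtain ⟨N', h⟩ := (((h0.comp_affine W₃ q).comp_relu W₂ b₂).comp_relu W₁ b₁).exists_eval
  refine ⟨N', fun x => ?_⟩
  rw [h]
  congr 1
  funext i
  have habs (t : ℝ) : relu t + relu (-t) = |t| := by
    rcases le_total 0 t with ht | ht <;> simp [relu, ht, abs_of_nonneg, abs_of_nonpos]
  have hsub (t : ℝ) : relu t - relu (-t) = t := by
    rcases le_total 0 t with ht | ht <;> simp [relu, ht]
  have hidem (t : ℝ) : relu (relu t) = relu t := by simp [relu]
  have hneg (i : Fin n) : -x i + (q i : ℝ) = -(x i - q i) := by ring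
  simp only [W₃, W₂, b₂, W₁, b₁, Fintype.sum_option, Fintype.sum_sum_type, Sum.elim_inl,
    Sum.elim_inr, ratCast_ite, Rat.cast_one, Rat.cast_zero, Rat.cast_neg, Rat.cast_natCast,
    ite_mul, one_mul, zero_mul, neg_mul, Finset.sum_ite_eq, Finset.mem_univ, if_true, add_zero,
    Sum.inl.injEq, Sum.inr.injEq, reduceCtorEq, if_false, Finset.sum_const_zero, zero_add,
    ← sub_eq_add_neg, hneg, hidem]
  have hb : bump q K x = relu (∑ j, -(K * relu (x j - q j)) +
      ∑ j, -(K * relu (-(x j - q j))) + 1) := by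
    rw [bump, ← Finset.sum_add_distrib, Finset.mul_sum, sub_eq_neg_add, ← Finset.sum_neg_distrib]
    congr 2
    refine Finset.sum_congr rfl fun j _ => ?_
    rw [← habs]
    ring
  rw [← hb]
  linarith [hsub (x i - q i)]

/-! ### Sets determined by finitely many hyperplanes -/

/-- The affine function whose zero set is the hyperplane with normal vector `h.1` and
offset `h.2`. -/
def affineForm {n : ℕ} (h : (Fin n → ℝ) × ℝ) (x : Fin n → ℝ) : ℝ := ∑ i, h.1 i * x i - h.2

theorem continuous_affineForm {n : ℕ} (h : (Fin n → ℝ) × ℝ) : Continuous (affineForm h) := by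
  unfold affineForm
  fun_prop

theorem affineForm_combo {n : ℕ} (h : (Fin n → ℝ) × ℝ) (x y : Fin n → ℝ) {s t : ℝ}
    (hst : s + t = 1) : affineForm h (s • x + t • y) = s * affineForm h x + t * affineForm h y := by
  have h1 : ∑ i, h.1 i * (s • x + t • y) i = s * ∑ i, h.1 i * x i + t * ∑ i, h.1 i * y i := by
    rw [Finset.mul_sum, Finset.mul_sum, ← Finset.sum_add_distrib]
    refine Finset.sum_congr rfl fun i _ => ?_
    simp only [Pi.add_apply, Pi.smul_apply, smul_eq_mul]
    ring
  unfold affineForm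
  rw [h1]
  linear_combination h.2 * hst

/-- A point of the hyperplane is left by an arbitrarily small step along the normal vector. -/
theorem dense_affineForm_ne_zero {n : ℕ} {h : (Fin n → ℝ) × ℝ} (hh : h.1 ≠ 0) :
    Dense {x | affineForm h x ≠ 0} := by
  intro x
  by_cases hx : affineForm h x = 0
  · have hpos : ∑ i, h.1 i * h.1 i ≠ 0 := by
      intro h0
      exact hh (dotProduct_self_eq_zero.1 h0)
    have hline (t : ℝ) : affineForm h (x + t • h.1) = t * ∑ i, h.1 i * h.1 i := by
      have : affineForm h (x + t • h.1) = affineForm h x + t * ∑ i, h.1 i * h.1 i := by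
        simp only [affineForm, Pi.add_apply, Pi.smul_apply, smul_eq_mul, mul_add,
          Finset.sum_add_distrib, Finset.mul_sum, mul_left_comm]
        ring
      rw [this, hx, zero_add]
    have hc : ContinuousAt (fun t : ℝ => x + t • h.1) 0 := by fun_prop
    refine mem_closure_of_tendsto (b := nhdsWithin (0 : ℝ) {0}ᶜ) (f := fun t => x + t • h.1) ?_ ?_
    · simpa using hc.tendsto.mono_left nhdsWithin_le_nhds
    · filter_upwards [self_mem_nhdsWithin] with t ht
      rw [hline]
      exact mul_ne_zero ht hpos
  · exact subset_closure hx

/-- The points `x` and `y` lie on the same side of each of the hyperplanes. -/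
def SameSide {n : ℕ} (H : Finset ((Fin n → ℝ) × ℝ)) (x y : Fin n → ℝ) : Prop :=
  ∀ h ∈ H, SignType.sign (affineForm h x) = SignType.sign (affineForm h y)

theorem SameSide.mono {n : ℕ} {H H' : Finset ((Fin n → ℝ) × ℝ)} (hH : H ⊆ H') {x y : Fin n → ℝ}
    (h : SameSide H' x y) : SameSide H x y :=
  fun a ha => h a (hH ha)

theorem SameSide.symm {n : ℕ} {H : Finset ((Fin n → ℝ) × ℝ)} {x y : Fin n → ℝ}
    (h : SameSide H x y) : SameSide H y x :=
  fun a ha => (h a ha).symm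

theorem SameSide.trans {n : ℕ} {H : Finset ((Fin n → ℝ) × ℝ)} {x y z : Fin n → ℝ}
    (h : SameSide H x y) (h' : SameSide H y z) : SameSide H x z :=
  fun a ha => (h a ha).trans (h' a ha)

theorem convex_sameSide {n : ℕ} (H : Finset ((Fin n → ℝ) × ℝ)) (p : Fin n → ℝ) :
    Convex ℝ {x | SameSide H p x} := by
  intro x hx y hy s t hs ht hst h hh
  have h1 := hx h hh
  have h2 := hy h hh
  rw [affineForm_combo h x y hst]
  rw [h1] at h2 ⊢
  generalize affineForm h x = u at *
  generalize affineForm h y = w at *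
  rcases lt_trichotomy u 0 with hu | hu | hu
  · rw [sign_neg hu] at h2 ⊢
    have hw := sign_eq_neg_one_iff.1 h2.symm
    refine (sign_neg ?_).symm
    -- Only one weight is sure to be positive; if `s = 0`, then `t = 1` and the sign of `w` decides.
    rcases hs.eq_or_lt with rfl | hs
    · rw [zero_add] at hst
      rwa [hst, zero_mul, zero_add, one_mul]
    · nlinarith [mul_neg_of_pos_of_neg hs hu, mul_nonpos_of_nonneg_of_nonpos ht hw.le]
  · rw [hu, sign_zero] at h2 ⊢
    have hw := sign_eq_zero_iff.1 h2.symm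
    simp [hw]
  · rw [sign_pos hu] at h2 ⊢
    have hw := sign_eq_one_iff.1 h2.symm
    refine (sign_pos ?_).symm
    rcases hs.eq_or_lt with rfl | hs
    · rw [zero_add] at hst
      rwa [hst, zero_mul, zero_add, one_mul]
    · nlinarith [mul_pos hs hu, mul_nonneg ht hw.le]

/-- Off the hyperplanes all signs are `±1`, so the cell is cut out by strict inequalities. -/
theorem isOpen_sameSide {n : ℕ} {H : Finset ((Fin n → ℝ) × ℝ)} {p : Fin n → ℝ}
    (hp : ∀ h ∈ H, affineForm h p ≠ 0) : IsOpen {x | SameSide H p x} := by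
  have : {x | SameSide H p x} =
      ⋂ h ∈ H, {x | SignType.sign (affineForm h p) = SignType.sign (affineForm h x)} := by
    ext x
    simp [SameSide]
  rw [this]
  refine H.finite_toSet.isOpen_biInter fun h hh => ?_
  rcases (hp h hh).lt_or_gt with hu | hu
  · simp only [sign_neg hu, eq_comm (a := (-1 : SignType)), sign_eq_neg_one_iff]
    exact isOpen_lt (continuous_affineForm h) continuous_const
  · simp only [sign_pos hu, eq_comm (a := (1 : SignType)), sign_eq_one_iff]
    exact isOpen_lt continuous_const (continuous_affineForm h)

/-- Membership in `S` depends only on the position relative to finitely many hyperplanes. -/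
def IsDetermined {n : ℕ} (S : Set (Fin n → ℝ)) : Prop :=
  ∃ H : Finset ((Fin n → ℝ) × ℝ), (∀ h ∈ H, h.1 ≠ 0) ∧
    ∀ x y, SameSide H x y → (x ∈ S ↔ y ∈ S)

theorem exists_common_hyperplanes {n : ℕ} {ι : Type} [Finite ι] {S : ι → Set (Fin n → ℝ)}
    (hS : ∀ i, IsDetermined (S i)) :
    ∃ H : Finset ((Fin n → ℝ) × ℝ), (∀ h ∈ H, h.1 ≠ 0) ∧
      ∀ x y, SameSide H x y → ∀ i, x ∈ S i ↔ y ∈ S i := by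
  classical
  have := Fintype.ofFinite ι
  choose H hH hd using hS
  refine ⟨Finset.univ.biUnion H, fun h hh => ?_, fun x y hxy i => hd i x y (hxy.mono ?_)⟩
  · obtain ⟨i, -, hi⟩ := Finset.mem_biUnion.1 hh
    exact hH i h hi
  · exact Finset.subset_biUnion_of_mem H (Finset.mem_univ i)

theorem IsDetermined.of_isBooleanCombination {n : ℕ} {G : Set (Set (Fin n → ℝ))}
    (hG : ∀ S ∈ G, IsDetermined S) {S : Set (Fin n → ℝ)} (hS : IsBooleanCombination G S) :
    IsDetermined S := by
  classical
  unfold IsBooleanCombination at hS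
  induction hS using BooleanSubalgebra.closure_bot_sup_induction with
  | mem S h => exact hG S h
  | bot => exact ⟨∅, by simp, fun x y _ => Iff.rfl⟩
  | sup S _ T _ hS hT =>
    obtain ⟨H, hH, hd⟩ := exists_common_hyperplanes (S := fun b : Bool => bif b then S else T)
      (fun b => by cases b <;> assumption)
    exact ⟨H, hH, fun x y hxy => or_congr (hd x y hxy true) (hd x y hxy false)⟩
  | compl S _ hS =>
    obtain ⟨H, hH, hd⟩ := hS
    exact ⟨H, hH, fun x y hxy => not_congr (hd x y hxy)⟩

theorem isDetermined_of_mem_halfSpaces {n : ℕ} {S : Set (Fin n → ℝ)} (hS : S ∈ halfSpaces n) :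
    IsDetermined S := by
  obtain ⟨a, c, ha, rfl⟩ := hS
  refine ⟨{(a, c)}, by simpa using ha, fun x y hxy => ?_⟩
  have h := hxy _ (Finset.mem_singleton_self _)
  have key (z : Fin n → ℝ) : z ∈ {x : Fin n → ℝ | ∑ i, a i * x i ≤ c} ↔
      SignType.sign (affineForm (a, c) z) ≤ 0 := by
    rw [sign_nonpos_iff, affineForm, sub_nonpos]
    rfl
  rw [key, key, h]

/-- An infinite endpoint gives the empty or the full set, for which no hyperplane is needed. -/
theorem isDetermined_coordinate_le {n : ℕ} (i : Fin n) (a : EReal) :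
    IsDetermined {x : Fin n → ℝ | (x i : EReal) ≤ a} := by
  induction a with
  | bot => exact ⟨∅, by simp, fun x y _ => by simp⟩
  | top => exact ⟨∅, by simp, fun x y _ => by simp⟩
  | coe a =>
    refine isDetermined_of_mem_halfSpaces ⟨Pi.single i 1, a, by simp, ?_⟩
    ext x
    simp [Pi.single_apply]

theorem isDetermined_le_coordinate {n : ℕ} (i : Fin n) (a : EReal) :
    IsDetermined {x : Fin n → ℝ | a ≤ (x i : EReal)} := by
  induction a with
  | bot => exact ⟨∅, by simp, fun x y _ => by simp⟩
  | top => exact ⟨∅, by simp, fun x y _ => by simp⟩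
  | coe a =>
    refine isDetermined_of_mem_halfSpaces ⟨Pi.single i (-1), -a, by simp, ?_⟩
    ext x
    simp [Pi.single_apply]

theorem isDetermined_of_mem_paraxialSets {n : ℕ} {S : Set (Fin n → ℝ)}
    (hS : S ∈ paraxialSets n) : IsDetermined S := by
  obtain ⟨i, a, b, rfl | rfl⟩ := hS
  · obtain ⟨H, hH, hd⟩ := exists_common_hyperplanes
      (S := fun t : Bool => bif t then {x : Fin n → ℝ | a ≤ (x i : EReal)}
        else {x | (x i : EReal) ≤ b})
      (fun t => by
        cases t
        · exact isDetermined_coordinate_le i b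
        · exact isDetermined_le_coordinate i a)
    exact ⟨H, hH, fun x y hxy => and_congr (hd x y hxy true) (hd x y hxy false)⟩
  · obtain ⟨H, hH, hd⟩ := exists_common_hyperplanes
      -- The strict bounds of the open interval are the negations of these two conditions.
      (S := fun t : Bool => bif t then {x : Fin n → ℝ | (x i : EReal) ≤ a}
        else {x | b ≤ (x i : EReal)})
      (fun t => by
        cases t
        · exact isDetermined_le_coordinate i b
        · exact isDetermined_coordinate_le i a)
    refine ⟨H, hH, fun x y hxy => ?_⟩
    exact and_congr (lt_iff_lt_of_le_iff_le (hd x y hxy true))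
      (lt_iff_lt_of_le_iff_le (hd x y hxy false))

/-- The condition of a propositional, oblique or MofN rule is determined by finitely many
hyperplanes. -/
theorem exists_implication_isDetermined {n m : ℕ} {r : Rule n m}
    (hr : r.IsPropositional ∨ r.IsOblique ∨ r.IsMofN) :
    ∃ φ ψ, r = .implication φ ψ ∧ IsDetermined φ := by
  rcases hr with ⟨φ, ψ, rfl, hφ, -⟩ | ⟨φ, ψ, rfl, hφ, -⟩ | ⟨φ, ψ, rfl, cmp, t, s, φs, hφs, hφ⟩
  · exact ⟨φ, ψ, rfl, .of_isBooleanCombination (fun _ => isDetermined_of_mem_paraxialSets) hφ⟩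
  · exact ⟨φ, ψ, rfl, .of_isBooleanCombination (fun _ => isDetermined_of_mem_halfSpaces) hφ⟩
  · obtain ⟨H, hH, hd⟩ := exists_common_hyperplanes fun i =>
      IsDetermined.of_isBooleanCombination (fun _ => isDetermined_of_mem_halfSpaces) (hφs i)
    refine ⟨φ, ψ, rfl, H, hH, fun x y hxy => ?_⟩
    -- The count depends only on which of the `φs i` contain the point.
    rw [hφ, hφ]
    simp only [hd x y hxy]

/-! ### Continuous functions that are constant on the cells of a hyperplane arrangement -/

/-- On the dense complement of the hyperplanes there are finitely many sign vectors, hence finitely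
many values. A finite set is closed, so it contains the whole range, which is connected and
therefore a single point. -/
theorem exists_eq_const_of_const_on_cells {n m : ℕ} {f : (Fin n → ℝ) → (Fin m → ℝ)}
    (hf : Continuous f) {H : Finset ((Fin n → ℝ) × ℝ)} (hH : ∀ h ∈ H, h.1 ≠ 0)
    (hconst : ∀ p, (∀ h ∈ H, affineForm h p ≠ 0) → ∀ x, SameSide H p x → f p = f x) :
    ∃ c, ∀ x, f x = c := by
  let U : Set (Fin n → ℝ) := ⋂ h ∈ H, {x | affineForm h x ≠ 0}
  have hU : Dense U := dense_biInter_of_isOpen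
    (fun h _ => isOpen_ne_fun (continuous_affineForm h) continuous_const)
    H.finite_toSet.countable (fun h hh => dense_affineForm_ne_zero (hH h hh))
  let sg : (Fin n → ℝ) → (H → SignType) := fun x h => SignType.sign (affineForm h.1 x)
  have hfin : (f '' U).Finite := by
    have hfac (x : U) (y : U) (hxy : sg x = sg y) : f x = f y :=
      hconst x (fun h hh => mem_iInter₂.1 x.2 h hh) y fun h hh => congrFun hxy ⟨h, hh⟩
    have : f '' U ⊆ ⋃ s : H → SignType, f '' {x ∈ U | sg x = s} := by
      rintro _ ⟨x, hx, rfl⟩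
      exact mem_iUnion.2 ⟨sg x, x, ⟨hx, rfl⟩, rfl⟩
    refine (finite_iUnion fun s => Set.Subsingleton.finite ?_).subset this
    rintro _ ⟨x, ⟨hx, hxs⟩, rfl⟩ _ ⟨y, ⟨hy, hys⟩, rfl⟩
    exact hfac ⟨x, hx⟩ ⟨y, hy⟩ (hxs.trans hys.symm)
  have hrange : range f ⊆ f '' U := by
    rw [← hfin.isClosed.closure_eq]
    exact hf.range_subset_closure_image_dense hU
  have hsub : (range f).Subsingleton :=
    (isPreconnected_range hf).isDiscrete_iff_subsingleton.1 (hfin.subset hrange).isDiscrete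
  exact ⟨f 0, fun x => hsub (mem_range_self x) (mem_range_self 0)⟩

theorem exists_rat_mem_of_isOpen {n : ℕ} {V : Set (Fin n → ℝ)} (hV : IsOpen V)
    (hne : V.Nonempty) : ∃ q : Fin n → ℚ, (fun i => (q i : ℝ)) ∈ V :=
  (DenseRange.piMap fun _ : Fin n => Rat.denseRange_cast (𝕜 := ℝ)).exists_mem_open hV hne

/-- If a network is not constant on an open convex set `C`, then some other network agrees with it
outside of `C` and takes on `C` only values that the given one takes on `C`. -/
theorem exists_perturbation (out : OutputActivation) {n m : ℕ} (N : ReLUNet n m)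
    {C : Set (Fin n → ℝ)} (hC : IsOpen C) (hconv : Convex ℝ C) {y z : Fin n → ℝ} (hy : y ∈ C)
    (hz : z ∈ C) (hyz : N.eval out y ≠ N.eval out z) :
    ∃ N' : ReLUNet n m, (∃ x, N'.eval out x ≠ N.eval out x) ∧
      ∀ x, ∃ x', N'.eval out x = N.eval out x' ∧ (x' = x ∨ x ∈ C ∧ x' ∈ C) := by
  have hf := continuous_eval out N
  -- Weights must be rational, so `y` and then `z` are replaced by nearby rational points of `C`
  -- whose values still differ.
  obtain ⟨q, hqC, hq⟩ := exists_rat_mem_of_isOpen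
    (hC.inter (isOpen_ne_fun hf continuous_const)) ⟨y, hy, hyz⟩
  obtain ⟨r, hrC, hr⟩ := exists_rat_mem_of_isOpen
    (hC.inter (isOpen_ne_fun hf continuous_const)) ⟨z, hz, Ne.symm hq⟩
  obtain ⟨ε, hε, hball⟩ := Metric.isOpen_iff.1 hC _ hqC
  obtain ⟨δ, hδ, hball'⟩ := Metric.isOpen_iff.1 hC _ hrC
  obtain ⟨K, hK⟩ := exists_nat_ge (1 / min ε δ)
  have hmin : 0 < min ε δ := lt_min hε hδ
  rw [div_le_iff₀ hmin] at hK
  -- The perturbation moves `q` exactly to `r`, so the new value at `q` is the old value at `r`.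
  obtain ⟨N', hN'⟩ := exists_eval_comp_bump out N q (r - q) K
  refine ⟨N', ⟨fun i => (q i : ℝ), ?_⟩, fun x => ⟨_, hN' x, ?_⟩⟩
  · rw [hN', bump_self]
    convert hr using 3
    simp
  · by_cases hx : bump q K x = 0
    · left
      simp [hx]
    · right
      have hd := dist_lt_of_bump_ne_zero hmin hK hx
      have hxC : x ∈ C := hball (hd.trans_le (min_le_left _ _))
      refine ⟨hxC, ?_⟩
      -- The translate of `x` by `r - q` is as close to `r` as `x` is to `q`. The perturbed point
      -- lies on the segment from `x` to this translate, with the bump as parameter, so convexity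
      -- keeps it in `C`.
      have hxC' : (fun i => x i + (r i - q i : ℝ)) ∈ C := by
        apply hball'
        rw [Metric.mem_ball]
        refine lt_of_eq_of_lt ?_ (hd.trans_le (min_le_right _ _))
        rw [dist_eq_norm, dist_eq_norm]
        congr 1
        funext i
        simp only [Pi.sub_apply]
        ring
      convert hconv hxC hxC' (sub_nonneg.2 (bump_le_one q K x)) (bump_nonneg q K x)
        (sub_add_cancel _ _) using 1
      funext i
      simp only [Pi.add_apply, Pi.smul_apply, smul_eq_mul, Pi.sub_apply, Rat.cast_sub]
      ring

/-! ### Consequences of exhaustiveness for the two kinds of rules -/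

theorem eval_const_of_exhaustive {out : OutputActivation} {n m : ℕ} {R : Set (Rule n m)}
    (hfin : R.Finite) (hexh : Exhaustive out R) {N : ReLUNet n m} (hN : N.Obeys out R)
    (hR : ∀ r ∈ R, r.IsPropositional ∨ r.IsOblique ∨ r.IsMofN) :
    ∃ c : Fin m → ℝ, ∀ x : Fin n → ℝ, N.eval out x = c := by
  have := hfin.to_subtype
  choose φ ψ hr hφ using fun r : R => exists_implication_isDetermined (hR r.1 r.2)
  obtain ⟨H, hH, hd⟩ := exists_common_hyperplanes hφ
  refine exists_eq_const_of_const_on_cells (continuous_eval out N) hH fun p hp x hpx => ?_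
  by_contra hne
  obtain ⟨N', ⟨w, hw⟩, hN'⟩ := exists_perturbation out N (isOpen_sameSide hp)
    (convex_sameSide H p) (fun _ _ => rfl) hpx hne
  refine hw (hexh w _ _ ⟨N', fun r hrR => ?_, rfl⟩ ⟨N, hN, rfl⟩)
  have hrN := hN r hrR
  have hr' := hr ⟨r, hrR⟩
  dsimp only at hr'
  rw [hr'] at hrN ⊢
  intro u hu
  -- The value at `u` is a value of `N` at a point `u'` that is `u` itself or in the same cell, so
  -- `u'` satisfies the condition too and the rule for `N` gives the conclusion.
  obtain ⟨u', hu', hcase⟩ := hN' u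
  rw [hu']
  refine hrN u' ?_
  rcases hcase with rfl | ⟨h1, h2⟩
  · exact hu
  · exact (hd u u' (SameSide.trans (SameSide.symm h1) h2) ⟨r, hrR⟩).1 hu

theorem Rule.Applies.add_one {n m : ℕ} {r : Rule n m} (hr : r.IsMonotonicity ∨ r.IsTotalMonotonicity)
    {f g : (Fin n → ℝ) → (Fin m → ℝ)} (hg : ∀ x i, g x i = f x i + 1) (h : r.Applies f) :
    r.Applies g := by
  rcases hr with ⟨l, A, i, rfl⟩ | ⟨l, A, i, rfl⟩
  · rintro x y ⟨hx, hxy⟩ j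
    rw [hg, hg]
    refine add_le_add_left (h x y ⟨fun k => ?_, hxy⟩ j) 1
    have := hx k
    rw [hg, hg] at this
    exact le_of_add_le_add_right this
  · intro x y hxy
    rw [hg, hg]
    exact add_le_add_left (h x y hxy) 1

end RuleExtraction

open RuleExtraction in
theorem mainTheorem4 (out : OutputActivation) (n m : ℕ) (R : Set (Rule n m)) (hfin : R.Finite)
    (hcons : Consistent out R) (hexh : Exhaustive out R)
    (N : ReLUNet n m) (hN : N.Obeys out R) :
    ((∀ r ∈ R, r.IsPropositional ∨ r.IsOblique ∨ r.IsMofN) →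
      ∃ c : Fin m → ℝ, ∀ x : Fin n → ℝ, N.eval out x = c) ∧
    (0 < m → ¬ ∀ r ∈ R, r.IsMonotonicity ∨ r.IsTotalMonotonicity) := by
  refine ⟨eval_const_of_exhaustive hfin hexh hN, fun hm hR => ?_⟩
  obtain ⟨N', hN'⟩ := exists_eval_add_one out N
  have h := hexh 0 _ _ ⟨N', fun r hr => (hN r hr).add_one (hR r hr) hN', rfl⟩ ⟨N, hN, rfl⟩
  -- An output node is needed to tell the two networks apart.
  have h0 := congrFun h ⟨0, hm⟩
  rw [hN'] at h0
  linarith
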